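/- For $r\ge 1$ let $d_r=2r(r+1)$ and let $\mathbb P^{2[d_r]}$ be the Hilbert scheme of zero-dimensional subschemes of length $d_r$ of the complex projective plane $\mathbb P^2$. Let $D_r\subset\mathbb P^{2[d_r]}$ be the divisor (the Brill--Noether divisor of $T_{\mathbb P^2}(2r-2)$) that is the complement of the open set of those $Z$ whose ideal sheaf has the resolution of a general $Z$, $$0\to\mathcal O_{\mathbb P^2}(-2(r+1))^{r}\to\mathcal O_{\mathbb P^2}(-2r)^{r+1}\to\mathscr I_Z\to 0 .$$ For a family $\mathscr A\subseteq\mathbb P^{2[d_r]}$ let $\mathscr L\mathscr A\subseteq\mathbb P^{2[d_{r+1}]}$ be the set of all $Z'$ that are residual to some $Z\in\mathscr A$ in a complete intersection of two plane curves of degree $2(r+1)$: there are curves $X=V(F)$ and $Y=V(G)$ of degree $2(r+1)$ (not necessarily smooth), without common component and both containing $Z$, such that $Z'=X\cap Y-Z$, that is, $I_{Z'}=(F,G):I_Z$ for the saturated homogeneous ideals. Proposition. For all $r\ge 1$, $$\mathscr L D_r\subseteq D_{r+1}.$$ -/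

import Mathlib

open MvPolynomial Filter

noncomputable section

namespace PlanePoints

attribute [local instance] MvPolynomial.gradedAlgebra

/-- The homogeneous coordinate ring `ℂ[x₀, x₁, x₂]` of the complex projective plane. -/
abbrev S : Type := MvPolynomial (Fin 3) ℂ

/-- The Hilbert function of `S / I`: the dimension over `ℂ` of the degree `k` part. -/
def hilbertFunction (I : Ideal S) (k : ℕ) : ℕ :=
  Module.finrank ℂ
    (homogeneousSubmodule (Fin 3) ℂ k ⧸
      (I.restrictScalars ℂ).comap (homogeneousSubmodule (Fin 3) ℂ k).subtype)

/-- A (closed) point of the Hilbert scheme of `n` points of the complex projective plane, that is,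
a closed subscheme of dimension zero and length `n` (not necessarily reduced). It is given by its
saturated homogeneous ideal `⨁ₖ H⁰(𝓘_Z(k))`, and its Hilbert polynomial is the constant `n`. -/
@[ext]
structure Hilb (n : ℕ) where
  ideal : Ideal S
  homogeneous : ideal.IsHomogeneous (homogeneousSubmodule (Fin 3) ℂ)
  saturated : ∀ f : S, (∀ i : Fin 3, X i * f ∈ ideal) → f ∈ ideal
  length_eq : ∀ᶠ k in atTop, hilbertFunction ideal k = n

/-- The tangential number `d_r = 2r(r+1)`. -/
def d (r : ℕ) : ℕ := 2 * r * (r + 1)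

/-- `I` has a graded free resolution
`0 → S(-2(r+1))^r → S(-2r)^(r+1) → I → 0`.
The two maps, being homogeneous of degree zero, are given by an `(r+1) × r` matrix `M` of quadratic
forms and by `r + 1` forms `g i` of degree `2r`. For a saturated ideal such resolutions are the same
as resolutions `0 → 𝒪(-2(r+1))^r → 𝒪(-2r)^(r+1) → 𝓘_Z → 0` of the ideal sheaf. They are
automatically minimal, as no entry of `M` is a nonzero constant. -/
def HasGenericResolution (r : ℕ) (I : Ideal S) : Prop :=
  ∃ (M : Matrix (Fin (r + 1)) (Fin r) S) (g : Fin (r + 1) → S),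
    (∀ i j, (M i j).IsHomogeneous 2) ∧
    (∀ i, (g i).IsHomogeneous (2 * r)) ∧
    Function.Injective M.mulVecLin ∧
    Function.Exact M.mulVecLin (Fintype.linearCombination S g) ∧
    LinearMap.range (Fintype.linearCombination S g) = I

/-- The divisor `D_r` in the Hilbert scheme of `d_r` points: the complement of the open set of
those `Z` that have the resolution of a general `Z`. -/
def D (r : ℕ) : Set (Hilb (d r)) :=
  {Z | ¬ HasGenericResolution r Z.ideal}

/-- `Z'` is residual to `Z` in a complete intersection of two curves of degree `a`: there are plane
curves `V(F)`, `V(G)` of degree `a` without common component, both containing `Z`, such that `Z'` is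
`V(F) ∩ V(G) - Z`, the subscheme with ideal `(F, G) : I_Z`. The curves need not be smooth. -/
def IsResidual (a : ℕ) {n m : ℕ} (Z : Hilb n) (Z' : Hilb m) : Prop :=
  ∃ F G : S, F ≠ 0 ∧ G ≠ 0 ∧ F.IsHomogeneous a ∧ G.IsHomogeneous a ∧ IsRelPrime F G ∧
    F ∈ Z.ideal ∧ G ∈ Z.ideal ∧
    Z'.ideal = (Ideal.span {F, G}).colon (Z.ideal : Set S)

/-- The family `𝓛 𝒜` of the residuals of the elements of `𝒜` in complete intersections of two
curves of degree `2(r+1)`. -/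
def L {r : ℕ} (A : Set (Hilb (d r))) : Set (Hilb (d (r + 1))) :=
  {Z' | ∃ Z ∈ A, IsResidual (2 * (r + 1)) Z Z'}

end PlanePoints

end

/-! The contrapositive is proved by liaison: if the residual `Z'` has the generic resolution for `r
+ 1`, then `Z` has it for `r`. The curves `F`, `G` are independent forms of the least degree in the
ideal of `Z'`, so they may be taken as its first two generators. Let `N` be the matrix of quadrics
obtained from the relation matrix `M` by deleting the two corresponding rows, `δ` its signed maximal
minors and `J` the ideal they generate. Pairing the relations with `δ` gives `F (M 0 ⬝ᵥ δ) + G (M 1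
⬝ᵥ δ) = 0`. Coprimality and degrees then force `M 1 ⬝ᵥ δ = c F` and `M 0 ⬝ᵥ δ = -c G` with `c` a
nonzero constant. So `δ` has no common factor, and by Hilbert–Burch `J` has the generic resolution
for `r`. An element `f` of the ideal of `Z` multiplies every generator of the ideal of `Z'` into
`(F, G)`, hence kills the cokernel of `N`; a trace argument puts it in `J`
(`mem_span_signedMinors_of_mul_eq`). Finally `J` has colength at least `d r` in large degrees, so
the saturated ideal of `Z`, of colength `d r`, cannot be smaller (`ideal_eq_of_le`). Biduality of
linkage is not needed. -/

namespace PlanePoints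

/-! ### Hilbert–Burch for maximal minors without common factor -/

section HilbertBurch

open Matrix

variable {R : Type*} {n : ℕ}

/-- The square matrix obtained by putting the row `u` on top of `N`. -/
def consRow (u : Fin (n + 1) → R) (N : Matrix (Fin n) (Fin (n + 1)) R) :
    Matrix (Fin (n + 1)) (Fin (n + 1)) R :=
  Matrix.of (Fin.cons u N)

@[simp]
theorem consRow_zero (u : Fin (n + 1) → R) (N : Matrix (Fin n) (Fin (n + 1)) R)
    (j : Fin (n + 1)) : consRow u N 0 j = u j := rfl

@[simp]
theorem consRow_succ (u : Fin (n + 1) → R) (N : Matrix (Fin n) (Fin (n + 1)) R)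
    (i : Fin n) (j : Fin (n + 1)) : consRow u N i.succ j = N i j := rfl

theorem consRow_submatrix (u : Fin (n + 1) → R) (N : Matrix (Fin n) (Fin (n + 1)) R)
    (j : Fin (n + 1)) :
    (consRow u N).submatrix Fin.succ j.succAbove = N.submatrix id j.succAbove := by
  rfl

variable [CommRing R]

/-- The signed maximal minors of an `n × (n + 1)` matrix. -/
def signedMinors (N : Matrix (Fin n) (Fin (n + 1)) R) : Fin (n + 1) → R :=
  fun j => (-1) ^ (j : ℕ) * (N.submatrix id j.succAbove).det

theorem det_consRow (u : Fin (n + 1) → R) (N : Matrix (Fin n) (Fin (n + 1)) R) :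
    (consRow u N).det = u ⬝ᵥ signedMinors N := by
  rw [det_succ_row_zero, dotProduct]
  refine Finset.sum_congr rfl fun j _ => ?_
  rw [consRow_submatrix, signedMinors]
  rw [consRow_zero]
  ring

theorem consRow_mulVec (u x : Fin (n + 1) → R) (N : Matrix (Fin n) (Fin (n + 1)) R) :
    consRow u N *ᵥ x = Fin.cons (u ⬝ᵥ x) (N *ᵥ x) := by
  ext i
  refine Fin.cases ?_ (fun i => ?_) i <;> rfl

theorem vecMul_consRow (u : Fin (n + 1) → R) (y : Fin (n + 1) → R)
    (N : Matrix (Fin n) (Fin (n + 1)) R) :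
    y ᵥ* consRow u N = y 0 • u + Nᵀ *ᵥ (Fin.tail y) := by
  ext j
  simp [vecMul, mulVec, dotProduct, Fin.sum_univ_succ, Fin.tail, mul_comm]

theorem adjugate_consRow_zero (u : Fin (n + 1) → R) (N : Matrix (Fin n) (Fin (n + 1)) R)
    (j : Fin (n + 1)) : (consRow u N).adjugate j 0 = signedMinors N j := by
  rw [adjugate_fin_succ_eq_det_submatrix]
  have := consRow_submatrix u N j
  simp only [Fin.succAbove_zero, Fin.val_zero, zero_add, signedMinors]
  rw [this]

theorem mulVec_signedMinors (N : Matrix (Fin n) (Fin (n + 1)) R) :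
    N *ᵥ signedMinors N = 0 := by
  ext i
  have h : (consRow (N i) N).det = 0 := by
    refine det_zero_of_row_eq (i := 0) (j := i.succ) (Fin.succ_ne_zero i).symm ?_
    rfl
  rw [det_consRow] at h
  exact h

/-- Cramer's rule for `consRow u N`: only the top entry of its product with `x` survives, and the
first column of the adjugate consists of the signed minors. -/
theorem smul_eq_smul_signedMinors {N : Matrix (Fin n) (Fin (n + 1)) R} {x : Fin (n + 1) → R}
    (hx : N *ᵥ x = 0) (u : Fin (n + 1) → R) :
    (u ⬝ᵥ signedMinors N) • x = (u ⬝ᵥ x) • signedMinors N := by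
  have h : (consRow u N).adjugate *ᵥ (consRow u N *ᵥ x) = (u ⬝ᵥ signedMinors N) • x := by
    rw [mulVec_mulVec, adjugate_mul, det_consRow, smul_mulVec, one_mulVec]
  rw [← h, consRow_mulVec, hx]
  ext j
  simp [mulVec, dotProduct, Fin.sum_univ_succ, adjugate_consRow_zero, mul_comm]

/-- By Cramer's rule the left side is a combination of the rows of `consRow v N`, in which the
coefficient of the top row `v` is `u ⬝ᵥ signedMinors N = 0`. -/
theorem exists_smul_eq_transpose_mulVec {N : Matrix (Fin n) (Fin (n + 1)) R}
    {u : Fin (n + 1) → R} (hu : u ⬝ᵥ signedMinors N = 0) (v : Fin (n + 1) → R) :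
    ∃ w, (v ⬝ᵥ signedMinors N) • u = Nᵀ *ᵥ w := by
  have h : (u ᵥ* (consRow v N).adjugate) ᵥ* consRow v N = (v ⬝ᵥ signedMinors N) • u := by
    rw [vecMul_vecMul, adjugate_mul, det_consRow, vecMul_smul, vecMul_one]
  rw [vecMul_consRow] at h
  have h0 : (u ᵥ* (consRow v N).adjugate) 0 = 0 := by
    simp only [vecMul, dotProduct, adjugate_consRow_zero]
    exact hu
  rw [h0, zero_smul, zero_add] at h
  exact ⟨_, h.symm⟩

variable [IsDomain R]

theorem transpose_mulVec_injective {N : Matrix (Fin n) (Fin (n + 1)) R}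
    (hN : signedMinors N ≠ 0) : Function.Injective Nᵀ.mulVecLin := by
  rw [← LinearMap.ker_eq_bot, LinearMap.ker_eq_bot']
  intro w hw
  obtain ⟨j, hj⟩ := Function.ne_iff.1 hN
  have hdet : (consRow (Pi.single j 1) N).det ≠ 0 := by
    rw [det_consRow]
    simpa using hj
  have := eq_zero_of_vecMul_eq_zero hdet (v := Fin.cons 0 w) (by
    rw [vecMul_consRow, Fin.cons_zero, zero_smul, zero_add, Fin.tail_cons]
    exact hw)
  ext i
  simpa using congrFun this i.succ

variable [DecompositionMonoid R]

theorem exact_transpose_signedMinors {N : Matrix (Fin n) (Fin (n + 1)) R} {v v' : Fin (n + 1) → R}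
    (h0 : v ⬝ᵥ signedMinors N ≠ 0)
    (h : IsRelPrime (v ⬝ᵥ signedMinors N) (v' ⬝ᵥ signedMinors N)) :
    Function.Exact Nᵀ.mulVecLin (Fintype.linearCombination R (signedMinors N)) := by
  have hN : signedMinors N ≠ 0 := by
    rintro e
    simp [e] at h0
  intro u
  have hlc : Fintype.linearCombination R (signedMinors N) u = u ⬝ᵥ signedMinors N := by
    simp [Fintype.linearCombination_apply, dotProduct]
  rw [hlc]
  constructor
  · intro hu
    obtain ⟨w, hw⟩ := exists_smul_eq_transpose_mulVec hu v
    obtain ⟨w', hw'⟩ := exists_smul_eq_transpose_mulVec hu v'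
    set F := v ⬝ᵥ signedMinors N
    set G := v' ⬝ᵥ signedMinors N
    -- Both `F • u` and `G • u` lift through the injective `Nᵀ`; comparing the lifts shows that `F`
    -- divides `w`, so `u` itself lifts.
    have key : G • w = F • w' := by
      apply transpose_mulVec_injective hN
      simp only [map_smul, mulVecLin_apply, ← hw, ← hw', smul_smul, mul_comm]
    have hdvd : ∀ i, F ∣ w i := fun i => h.dvd_of_dvd_mul_left
      ⟨w' i, by simpa using congrFun key i⟩
    choose c hc using hdvd
    refine ⟨c, ?_⟩
    have : F • (Nᵀ *ᵥ c) = F • u := by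
      rw [hw, ← mulVec_smul]
      congr 1
      ext i
      simp [hc i]
    exact smul_right_injective _ h0 this
  · rintro ⟨w, rfl⟩
    rw [mulVecLin_apply, mulVec_transpose, ← dotProduct_mulVec, mulVec_signedMinors,
      dotProduct_zero]

theorem exists_smul_signedMinors_of_mulVec_eq_zero {N : Matrix (Fin n) (Fin (n + 1)) R}
    {v v' : Fin (n + 1) → R} (h0 : v ⬝ᵥ signedMinors N ≠ 0)
    (h : IsRelPrime (v ⬝ᵥ signedMinors N) (v' ⬝ᵥ signedMinors N))
    {x : Fin (n + 1) → R} (hx : N *ᵥ x = 0) : ∃ c : R, x = c • signedMinors N := by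
  have h1 := smul_eq_smul_signedMinors hx v
  have h2 := smul_eq_smul_signedMinors hx v'
  have hN : signedMinors N ≠ 0 := by
    rintro e
    simp [e] at h0
  set F := v ⬝ᵥ signedMinors N
  set G := v' ⬝ᵥ signedMinors N
  have key : (G * (v ⬝ᵥ x)) • signedMinors N = (F * (v' ⬝ᵥ x)) • signedMinors N := by
    rw [mul_smul, mul_smul, ← h1, ← h2, smul_smul, smul_smul, mul_comm]
  have key' := smul_left_injective R hN key
  obtain ⟨c, hc⟩ := h.dvd_of_dvd_mul_left ⟨_, key'⟩
  refine ⟨c, smul_right_injective _ h0 ?_⟩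
  simp only [smul_smul, h1, hc]

/-- An element annihilating the cokernel of `N` lies in the ideal of maximal minors, if these have
no common factor. -/
theorem mem_span_signedMinors_of_mul_eq {N : Matrix (Fin n) (Fin (n + 1)) R}
    {v v' : Fin (n + 1) → R} (h0 : v ⬝ᵥ signedMinors N ≠ 0)
    (h : IsRelPrime (v ⬝ᵥ signedMinors N) (v' ⬝ᵥ signedMinors N))
    {f : R} {V : Matrix (Fin (n + 1)) (Fin n) R} (hV : N * V = f • 1) :
    f ∈ Ideal.span (Set.range (signedMinors N)) := by
  have hcol : ∀ j, ∃ c : R, (f • (1 : Matrix (Fin (n + 1)) (Fin (n + 1)) R) - V * N).col j =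
      c • signedMinors N := by
    intro j
    refine exists_smul_signedMinors_of_mulVec_eq_zero h0 h ?_
    have : N * (f • (1 : Matrix (Fin (n + 1)) (Fin (n + 1)) R) - V * N) = 0 := by
      rw [Matrix.mul_sub, ← Matrix.mul_assoc, hV]
      simp
    ext i
    exact congrFun (congrFun this i) j
  choose c hc using hcol
  -- The columns of `f • 1 - V * N` are multiples of the minors, and its trace is `(n + 1) f - n f =
  -- f`.
  have htr : trace (f • (1 : Matrix (Fin (n + 1)) (Fin (n + 1)) R) - V * N) = f := by
    rw [trace_sub, trace_mul_comm, hV]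
    simp only [trace_smul, trace_one, Fintype.card_fin, smul_eq_mul]
    push_cast
    ring
  rw [← htr, trace]
  refine Ideal.sum_mem _ fun j _ => ?_
  have h1 : (f • (1 : Matrix (Fin (n + 1)) (Fin (n + 1)) R) - V * N).diag j =
      c j * signedMinors N j := congrFun (hc j) j
  rw [h1]
  exact Ideal.mul_mem_left _ _ (Ideal.subset_span ⟨j, rfl⟩)

end HilbertBurch

attribute [local instance] MvPolynomial.gradedAlgebra

/-! ### Degrees of minors and dimensions of spaces of forms -/

section Homogeneous

theorem isHomogeneous_det {σ R : Type*} [CommRing R] {n k : ℕ}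
    {A : Matrix (Fin n) (Fin n) (MvPolynomial σ R)} (hA : ∀ i j, (A i j).IsHomogeneous k) :
    A.det.IsHomogeneous (k * n) := by
  rw [Matrix.det_apply]
  refine IsHomogeneous.sum _ _ _ fun s _ => ?_
  have h : (∏ i, A (s i) i).IsHomogeneous (k * n) := by
    simpa [mul_comm] using IsHomogeneous.prod Finset.univ (fun i => A (s i) i) (fun _ => k)
      fun i _ => hA _ _
  rcases Int.units_eq_one_or (Equiv.Perm.sign s) with e | e <;> rw [e]
  · simpa using h
  · simpa using h.neg

theorem isHomogeneous_signedMinors {σ R : Type*} [CommRing R] {n k : ℕ}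
    {N : Matrix (Fin n) (Fin (n + 1)) (MvPolynomial σ R)} (hN : ∀ i j, (N i j).IsHomogeneous k)
    (j : Fin (n + 1)) : (signedMinors N j).IsHomogeneous (k * n) := by
  have h : (N.submatrix id j.succAbove).det.IsHomogeneous (k * n) :=
    isHomogeneous_det fun _ _ => hN _ _
  rcases neg_one_pow_eq_or (MvPolynomial σ R) (j : ℕ) with e | e <;> rw [signedMinors, e]
  · simpa using h
  · simpa using h.neg

theorem homogeneousComponent_mul_of_isHomogeneous {σ R : Type*} [CommRing R] {m n : ℕ}
    (a : MvPolynomial σ R) {g : MvPolynomial σ R} (hg : g.IsHomogeneous n) :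
    homogeneousComponent (m + n) (a * g) = homogeneousComponent m a * g := by
  rw [← decomposition.decompose'_apply, ← decomposition.decompose'_apply]
  exact DirectSum.coe_decompose_mul_add_of_right_mem (homogeneousSubmodule σ R)
    (a := a) (i := m) (j := n) ((mem_homogeneousSubmodule n g).2 hg)

instance (k : ℕ) : FiniteDimensional ℂ (homogeneousSubmodule (Fin 3) ℂ k) :=
  Module.Finite.iff_fg.2 (homogeneousSubmodule_fg (Fin 3) ℂ k)

theorem finrank_homogeneousSubmodule (k : ℕ) :
    Module.finrank ℂ (homogeneousSubmodule (Fin 3) ℂ k) = (k + 2).choose 2 := by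
  have h : {e : Fin 3 →₀ ℕ | e.degree = k} =
      ((Finset.univ : Finset (Fin 3)).finsuppAntidiag k : Set (Fin 3 →₀ ℕ)) := by
    ext e
    simp [Finsupp.degree_eq_sum]
  rw [homogeneousSubmodule_eq_finsupp_supported]
  have e := AddMonoidAlgebra.supportedEquivFinsupp (R := ℂ) (S := ℂ)
    {e : Fin 3 →₀ ℕ | e.degree = k}
  rw [e.finrank_eq, h, Module.finrank_finsupp_self]
  simp only [Finset.coe_sort_coe, Fintype.card_coe, Finset.card_finsuppAntidiag_nat_eq_choose,
    Finset.card_univ, Fintype.card_fin]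
  rw [show 3 + k - 1 = k + 2 by omega, Nat.choose_symm_add]

end Homogeneous

/-! ### Colength of an ideal with a generic resolution -/

section HilbertFunction

/-- The degree `k` part of an ideal. -/
noncomputable def degreePart (I : Ideal S) (k : ℕ) : Submodule ℂ (homogeneousSubmodule (Fin 3) ℂ k) :=
  (I.restrictScalars ℂ).comap (homogeneousSubmodule (Fin 3) ℂ k).subtype

theorem mem_degreePart {I : Ideal S} {k : ℕ} {x : homogeneousSubmodule (Fin 3) ℂ k} :
    x ∈ degreePart I k ↔ (x : S) ∈ I := Iff.rfl

theorem hilbertFunction_add_finrank (I : Ideal S) (k : ℕ) :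
    hilbertFunction I k + Module.finrank ℂ (degreePart I k) = (k + 2).choose 2 := by
  rw [← finrank_homogeneousSubmodule]
  exact Submodule.finrank_quotient_add_finrank _

/-- Dimension count in one graded piece of the resolution. An inequality suffices: `Φ` covers the
degree part, and its kernel contains the image of the injective `Ψ`. -/
theorem finrank_degreePart_add_le {r : ℕ} {I : Ideal S} (h : HasGenericResolution r I) (m : ℕ) :
    Module.finrank ℂ (degreePart I (m + 2 + 2 * r)) + r * (m + 2).choose 2 ≤
      (r + 1) * (m + 4).choose 2 := by
  obtain ⟨M, g, hM, hg, hinj, hex, hrange⟩ := h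
  let A (k : ℕ) := homogeneousSubmodule (Fin 3) ℂ k
  have hΦ (x : Fin (r + 1) → A (m + 2)) :
      (Fintype.linearCombination S g) (fun i => (x i : S)) ∈ A (m + 2 + 2 * r) := by
    rw [Fintype.linearCombination_apply]
    exact Submodule.sum_mem _ fun i _ => IsHomogeneous.mul (x i).2 (hg i)
  have hΨ (x : Fin r → A m) (i : Fin (r + 1)) : M.mulVecLin (fun i => (x i : S)) i ∈ A (m + 2) := by
    rw [Matrix.mulVecLin_apply, Matrix.mulVec, dotProduct]
    refine Submodule.sum_mem _ fun j _ => ?_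
    rw [add_comm m]
    exact IsHomogeneous.mul (hM i j) (x j).2
  let Φ : (Fin (r + 1) → A (m + 2)) →ₗ[ℂ] A (m + 2 + 2 * r) :=
    { toFun := fun x => ⟨_, hΦ x⟩
      map_add' := fun x y => Subtype.ext ((Fintype.linearCombination S g).map_add _ _)
      map_smul' := fun c x => Subtype.ext
        (((Fintype.linearCombination S g).restrictScalars ℂ).map_smul c _) }
  let Ψ : (Fin r → A m) →ₗ[ℂ] (Fin (r + 1) → A (m + 2)) :=
    { toFun := fun x i => ⟨_, hΨ x i⟩
      map_add' := fun x y => funext fun i => Subtype.ext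
        (congrFun (M.mulVecLin.map_add (fun i => (x i : S)) (fun i => (y i : S))) i)
      map_smul' := fun c x => funext fun i => Subtype.ext
        (congrFun ((M.mulVecLin.restrictScalars ℂ).map_smul c (fun i => (x i : S))) i) }
  have hΨinj : Function.Injective Ψ := by
    intro x y hxy
    have : (fun i => (x i : S)) = fun i => (y i : S) := by
      apply hinj
      ext1 i
      exact congrArg Subtype.val (congrFun hxy i)
    ext1 i
    exact Subtype.ext (congrFun this i)
  have hle : LinearMap.range Ψ ≤ LinearMap.ker Φ := by
    rintro _ ⟨x, rfl⟩
    exact Subtype.ext ((hex _).2 ⟨_, rfl⟩)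
  have hdeg : degreePart I (m + 2 + 2 * r) ≤ LinearMap.range Φ := by
    rintro ⟨f, hf⟩ hfI
    rw [mem_degreePart, ← hrange] at hfI
    obtain ⟨a, ha⟩ := hfI
    refine ⟨fun i => ⟨homogeneousComponent (m + 2) (a i), homogeneousComponent_mem _ _⟩, ?_⟩
    refine Subtype.ext ?_
    change Fintype.linearCombination S g _ = f
    rw [← homogeneousComponent_eq_self hf]
    change _ = homogeneousComponent (m + 2 + 2 * r) f
    rw [← show _ = f from ha, Fintype.linearCombination_apply, Fintype.linearCombination_apply,
      map_sum]
    exact Finset.sum_congr rfl fun i _ =>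
      (homogeneousComponent_mul_of_isHomogeneous (a i) (hg i)).symm
  have h1 := LinearMap.finrank_range_add_finrank_ker Φ
  have h2 := Submodule.finrank_mono hle
  have h3 := Submodule.finrank_mono hdeg
  rw [LinearMap.finrank_range_of_inj hΨinj] at h2
  simp only [A, Module.finrank_pi_fintype, Finset.sum_const, Finset.card_univ, Fintype.card_fin,
    finrank_homogeneousSubmodule, smul_eq_mul] at h1 h2
  rw [show m + 2 + 2 = m + 4 from rfl] at h1
  omega

theorem choose_two_add_eq (m r : ℕ) :
    (m + 2 + 2 * r + 2).choose 2 + r * (m + 2).choose 2 = (r + 1) * (m + 4).choose 2 + d r := by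
  have : (((m + 2 + 2 * r + 2).choose 2 + r * (m + 2).choose 2 : ℕ) : ℚ) =
      ((r + 1) * (m + 4).choose 2 + d r : ℕ) := by
    simp only [d]
    push_cast [Nat.cast_choose_two]
    ring
  exact_mod_cast this

theorem le_hilbertFunction {r : ℕ} {I : Ideal S} (h : HasGenericResolution r I) (m : ℕ) :
    d r ≤ hilbertFunction I (m + 2 + 2 * r) := by
  have h1 := finrank_degreePart_add_le h m
  have h2 := choose_two_add_eq m r
  have h3 := hilbertFunction_add_finrank I (m + 2 + 2 * r)
  omega

theorem mem_of_forall_isHomogeneous_mul_mem {n : ℕ} (Z : Hilb n) {f : S} (k : ℕ)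
    (h : ∀ p : S, p.IsHomogeneous k → p * f ∈ Z.ideal) : f ∈ Z.ideal := by
  induction k with
  | zero => simpa using h 1 (isHomogeneous_one _ _)
  | succ k ih =>
    refine ih fun p hp => Z.saturated _ fun i => ?_
    rw [← mul_assoc]
    refine h _ ?_
    rw [add_comm]
    exact (isHomogeneous_X ℂ i).mul hp

/-- A saturated ideal of colength `d r` contained in one with a generic resolution is equal to it. -/
theorem ideal_eq_of_le {r : ℕ} (Z : Hilb (d r)) {J : Ideal S} (h : HasGenericResolution r J)
    (hle : Z.ideal ≤ J) : Z.ideal = J := by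
  refine le_antisymm hle ?_
  obtain ⟨k₀, hk₀⟩ := eventually_atTop.1 Z.length_eq
  -- In one large degree the inclusion is an equality by dimension; saturation then brings each
  -- generator of `J` back down into the ideal of `Z`.
  have hdeg : degreePart Z.ideal (k₀ + 2 + 2 * r) = degreePart J (k₀ + 2 + 2 * r) := by
    refine Submodule.eq_of_le_of_finrank_le (fun x hx => hle hx) ?_
    have h1 := le_hilbertFunction h k₀
    have h2 := hk₀ (k₀ + 2 + 2 * r) (by omega)
    have h3 := hilbertFunction_add_finrank J (k₀ + 2 + 2 * r)
    have h4 := hilbertFunction_add_finrank Z.ideal (k₀ + 2 + 2 * r)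
    omega
  obtain ⟨M, g, hM, hg, hinj, hex, rfl⟩ := h
  rintro _ ⟨a, rfl⟩
  rw [Fintype.linearCombination_apply]
  refine Ideal.sum_mem _ fun i _ => Ideal.mul_mem_left _ _ ?_
  refine mem_of_forall_isHomogeneous_mul_mem Z (k₀ + 2) fun p hp => ?_
  have hmem : (⟨p * g i, hp.mul (hg i)⟩ : homogeneousSubmodule (Fin 3) ℂ (k₀ + 2 + 2 * r)) ∈
      degreePart (LinearMap.range (Fintype.linearCombination S g)) (k₀ + 2 + 2 * r) := by
    refine ⟨Pi.single i p, ?_⟩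
    simp
  rw [← hdeg] at hmem
  exact hmem

end HilbertFunction

/-! ### Prescribing two of the generators -/

section ChangeOfGenerators

open Matrix

theorem exists_basis_extending {K : Type*} [Field K] {n : ℕ} {a b : Fin (n + 2) → K}
    (h : LinearIndependent K ![a, b]) :
    ∃ B : Module.Basis (Fin (n + 2)) K (Fin (n + 2) → K), B 0 = a ∧ B 1 = b := by
  let B := Module.Basis.sumExtend h
  have hfin := Module.Finite.finite_basis B
  have : Finite (Module.Basis.sumExtendIndex h) :=
    Finite.of_injective _ (Sum.inr_injective (α := Fin 2))
  have := Fintype.ofFinite (Module.Basis.sumExtendIndex h)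
  have hcard : Fintype.card (Module.Basis.sumExtendIndex h) = n := by
    have := Module.finrank_eq_card_basis B
    simp only [Module.finrank_fintype_fun_eq_card, Fintype.card_sum, Fintype.card_fin] at this
    omega
  let e : Fin 2 ⊕ Module.Basis.sumExtendIndex h ≃ Fin (n + 2) :=
    ((Equiv.refl _).sumCongr (Fintype.equivFinOfCardEq hcard)).trans
      (finSumFinEquiv.trans (finCongr (add_comm 2 n)))
  have hB (i : Fin 2) : B (Sum.inl i) = ![a, b] i := by
    simp [B, Module.Basis.sumExtend, Equiv.sumCongr]
    rfl
  refine ⟨B.reindex e, ?_, ?_⟩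
  · have : e.symm 0 = Sum.inl 0 := by
      rw [Equiv.symm_apply_eq]
      rfl
    rw [Module.Basis.reindex_apply, this, hB]
    rfl
  · have : e.symm 1 = Sum.inl 1 := by
      rw [Equiv.symm_apply_eq]
      rfl
    rw [Module.Basis.reindex_apply, this, hB]
    rfl

theorem linearCombination_eq_dotProduct {R ι : Type*} [CommRing R] [Fintype ι] (g x : ι → R) :
    Fintype.linearCombination R g x = x ⬝ᵥ g := by
  simp [Fintype.linearCombination_apply, dotProduct]

theorem exists_coeff_of_mem_range {n k : ℕ} {g : Fin n → S} (hg : ∀ i, (g i).IsHomogeneous k)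
    {F : S} (hF : F.IsHomogeneous k) (h : F ∈ LinearMap.range (Fintype.linearCombination S g)) :
    ∃ a : Fin n → ℂ, F = (fun i => C (a i)) ⬝ᵥ g := by
  obtain ⟨x, rfl⟩ := h
  refine ⟨fun i => coeff 0 (x i), ?_⟩
  rw [linearCombination_eq_dotProduct] at hF ⊢
  conv_lhs => rw [← homogeneousComponent_eq_self hF]
  simp only [dotProduct, map_sum]
  refine Finset.sum_congr rfl fun i _ => ?_
  have := homogeneousComponent_mul_of_isHomogeneous (m := 0) (x i) (hg i)
  rwa [zero_add, homogeneousComponent_zero] at this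

theorem isHomogeneous_mul_apply {σ R : Type*} [CommRing R] {l m n : Type*} [Fintype m] {j k : ℕ}
    {A : Matrix l m (MvPolynomial σ R)} {B : Matrix m n (MvPolynomial σ R)}
    (hA : ∀ a b, (A a b).IsHomogeneous j) (hB : ∀ a b, (B a b).IsHomogeneous k) (a : l) (b : n) :
    ((A * B) a b).IsHomogeneous (j + k) := by
  rw [mul_apply]
  exact IsHomogeneous.sum _ _ _ fun c _ => (hA a c).mul (hB c b)

/-- Two independent forms of least degree can be taken as the first two generators. -/
theorem HasGenericResolution.exists_extending {r : ℕ} {I : Ideal S}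
    (h : HasGenericResolution (r + 1) I) {F G : S} (hF : F ∈ I) (hG : G ∈ I)
    (hFh : F.IsHomogeneous (2 * (r + 1))) (hGh : G.IsHomogeneous (2 * (r + 1)))
    (hli : ∀ s t : ℂ, C s * F + C t * G = 0 → s = 0 ∧ t = 0) :
    ∃ (M : Matrix (Fin (r + 2)) (Fin (r + 1)) S) (g : Fin (r + 2) → S),
      (∀ i j, (M i j).IsHomogeneous 2) ∧
      Function.Injective M.mulVecLin ∧
      Function.Exact M.mulVecLin (Fintype.linearCombination S g) ∧
      LinearMap.range (Fintype.linearCombination S g) = I ∧ g 0 = F ∧ g 1 = G := by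
  obtain ⟨M, g, hM, hg, hinj, hex, rfl⟩ := h
  obtain ⟨a, ha⟩ := exists_coeff_of_mem_range hg hFh hF
  obtain ⟨b, hb⟩ := exists_coeff_of_mem_range hg hGh hG
  have hab : LinearIndependent ℂ ![a, b] := by
    rw [LinearIndependent.pair_iff]
    intro s t hst
    refine hli s t ?_
    have : C s * F + C t * G = (fun i => C ((s • a + t • b) i)) ⬝ᵥ g := by
      rw [ha, hb]
      simp only [dotProduct, Finset.mul_sum, ← Finset.sum_add_distrib]
      refine Finset.sum_congr rfl fun i _ => ?_
      simp only [Pi.add_apply, Pi.smul_apply, smul_eq_mul, map_add, map_mul]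
      ring
    rw [this, hst]
    simp [dotProduct]
  obtain ⟨B, hB0, hB1⟩ := exists_basis_extending hab
  -- A scalar change of basis whose first two columns are the coefficient vectors of `F` and `G`;
  -- being constant, it keeps the relations quadratic.
  let P : Matrix (Fin (r + 2)) (Fin (r + 2)) S := ((Pi.basisFun ℂ _).toMatrix B).map C
  let Q : Matrix (Fin (r + 2)) (Fin (r + 2)) S := (B.toMatrix (Pi.basisFun ℂ _)).map C
  have hPQ : P * Q = 1 := by
    rw [← Matrix.map_mul, Module.Basis.toMatrix_mul_toMatrix_flip, Matrix.map_one _ C_0 C_1]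
  have hQP : Q * P = 1 := by
    rw [← Matrix.map_mul, Module.Basis.toMatrix_mul_toMatrix_flip, Matrix.map_one _ C_0 C_1]
  have hP (i j) : P i j = C (B j i) := by
    simp [P, Module.Basis.toMatrix_apply]
  have hlc (x) : Fintype.linearCombination S (g ᵥ* P) x =
      Fintype.linearCombination S g (P *ᵥ x) := by
    rw [linearCombination_eq_dotProduct, linearCombination_eq_dotProduct, dotProduct_comm,
      ← dotProduct_mulVec, dotProduct_comm]
  refine ⟨Q * M, g ᵥ* P, ?_, ?_, ?_, ?_, ?_, ?_⟩
  · intro i j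
    simpa only [zero_add] using
      isHomogeneous_mul_apply (A := Q) (fun _ _ => isHomogeneous_C _ _) hM i j
  · intro x y hxy
    apply hinj
    simpa [mulVec_mulVec, ← Matrix.mul_assoc, hPQ] using congrArg (P *ᵥ ·) hxy
  · intro x
    rw [hlc, hex]
    constructor
    · rintro ⟨y, hy⟩
      refine ⟨y, ?_⟩
      rw [mulVecLin_apply] at hy ⊢
      rw [← mulVec_mulVec, hy, mulVec_mulVec, hQP, one_mulVec]
    · rintro ⟨y, rfl⟩
      refine ⟨y, ?_⟩
      rw [mulVecLin_apply, mulVecLin_apply, mulVec_mulVec, ← Matrix.mul_assoc, hPQ, Matrix.one_mul]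
  · ext f
    constructor
    · rintro ⟨x, rfl⟩
      exact ⟨_, (hlc x).symm⟩
    · rintro ⟨x, rfl⟩
      refine ⟨Q *ᵥ x, ?_⟩
      rw [hlc, mulVec_mulVec, hPQ, one_mulVec]
  · simp only [vecMul, hP, hB0]
    rw [dotProduct_comm, ha]
  · simp only [vecMul, hP, hB1]
    rw [dotProduct_comm, hb]

end ChangeOfGenerators

/-! ### Linkage and the deleted relation matrix -/

section Liaison

open Matrix

theorem smul_add_smul_eq_zero_of_isRelPrime {σ K : Type*} [Field K] {k : ℕ} (hk : k ≠ 0)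
    {F G : MvPolynomial σ K} (hG0 : G ≠ 0)
    (hG : G.IsHomogeneous k) (hFG : IsRelPrime F G) {s t : K} (h : C s * F + C t * G = 0) :
    s = 0 ∧ t = 0 := by
  have hs : s = 0 := by
    by_contra hs
    have hdvd : G ∣ F := by
      refine ⟨-(C (s⁻¹ * t)), ?_⟩
      have : C s⁻¹ * (C s * F + C t * G) = 0 := by rw [h, mul_zero]
      rw [mul_add, ← mul_assoc, ← C_mul, inv_mul_cancel₀ hs, C_1, one_mul, ← mul_assoc,
        ← C_mul] at this
      linear_combination this
    have hu : IsUnit G := hFG hdvd dvd_rfl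
    have h0 := (MvPolynomial.isUnit_iff_totalDegree_of_isReduced.1 hu).2
    rw [hG.totalDegree hG0] at h0
    exact hk h0
  subst hs
  simp only [C_0, zero_mul, zero_add, mul_eq_zero, hG0, or_false] at h
  exact ⟨rfl, by simpa using h⟩

theorem exists_eq_C_mul_of_dvd {σ K : Type*} [Field K] {k : ℕ} {F p : MvPolynomial σ K}
    (hp0 : p ≠ 0) (hF : F.IsHomogeneous k) (hp : p.IsHomogeneous k) (h : F ∣ p) :
    ∃ c : K, c ≠ 0 ∧ p = C c * F := by
  obtain ⟨q, rfl⟩ := h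
  have hF0 := left_ne_zero_of_mul hp0
  have hq0 := right_ne_zero_of_mul hp0
  have h1 := totalDegree_mul_of_isDomain hF0 hq0
  rw [hF.totalDegree hF0, hp.totalDegree hp0] at h1
  have h2 := totalDegree_eq_zero_iff_eq_C.1 (show q.totalDegree = 0 by omega)
  refine ⟨coeff 0 q, ?_, ?_⟩
  · intro h0
    rw [h0, C_0] at h2
    exact hq0 h2
  · rw [← h2, mul_comm]

/-- The ideal of maximal minors of a matrix of quadrics has a generic resolution, if the minors
have no common factor. -/
theorem hasGenericResolution_span_signedMinors {r : ℕ} {N : Matrix (Fin r) (Fin (r + 1)) S}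
    (hN : ∀ i j, (N i j).IsHomogeneous 2) {v v' : Fin (r + 1) → S}
    (h0 : v ⬝ᵥ signedMinors N ≠ 0)
    (h : IsRelPrime (v ⬝ᵥ signedMinors N) (v' ⬝ᵥ signedMinors N)) :
    HasGenericResolution r (Ideal.span (Set.range (signedMinors N))) := by
  refine ⟨Nᵀ, signedMinors N, fun i j => hN j i, isHomogeneous_signedMinors hN,
    transpose_mulVec_injective ?_, exact_transpose_signedMinors h0 h,
    Fintype.range_linearCombination _ _⟩
  rintro e
  simp [e] at h0

/-- This is the determinant of `M` without its row `0`. If `x` were a nonzero kernel vector of that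
square matrix, the relation `g ᵥ* M = 0` and `g 0 ≠ 0` would force `M *ᵥ x = 0`. -/
theorem dotProduct_signedMinors_ne_zero {R : Type*} [CommRing R] [IsDomain R] {n : ℕ}
    {M : Matrix (Fin (n + 2)) (Fin (n + 1)) R} {g : Fin (n + 2) → R} (hg0 : g 0 ≠ 0)
    (hgM : g ᵥ* M = 0) (hinj : Function.Injective M.mulVecLin) :
    M 1 ⬝ᵥ signedMinors (M.submatrix (fun i : Fin n => i.succ.succ) id) ≠ 0 := by
  rw [← det_consRow]
  intro h
  obtain ⟨x, hx0, hx⟩ := exists_mulVec_eq_zero_iff.2 h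
  have hx' (i : Fin (n + 1)) : (M *ᵥ x) i.succ = 0 := by
    refine Fin.cases ?_ (fun i => ?_) i
    · exact congrFun hx 0
    · exact congrFun hx i.succ
  have h1 : g ⬝ᵥ (M *ᵥ x) = 0 := by
    rw [dotProduct_mulVec, hgM, zero_dotProduct]
  simp only [dotProduct, Fin.sum_univ_succ (n := n + 1), hx', mul_zero, Finset.sum_const_zero,
    add_zero, mul_eq_zero, hg0, false_or] at h1
  refine hx0 (hinj ?_)
  rw [mulVecLin_apply, map_zero]
  ext i
  exact Fin.cases h1 hx' i

theorem mul_dotProduct_signedMinors_add {R : Type*} [CommRing R] {n : ℕ}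
    {M : Matrix (Fin (n + 2)) (Fin (n + 1)) R} {g : Fin (n + 2) → R} (hgM : g ᵥ* M = 0) :
    g 0 * (M 0 ⬝ᵥ signedMinors (M.submatrix (fun i : Fin n => i.succ.succ) id)) +
      g 1 * (M 1 ⬝ᵥ signedMinors (M.submatrix (fun i : Fin n => i.succ.succ) id)) = 0 := by
  set δ := signedMinors (M.submatrix (fun i : Fin n => i.succ.succ) id) with hδ
  have h1 : g ⬝ᵥ (M *ᵥ δ) = 0 := by
    rw [dotProduct_mulVec, hgM, zero_dotProduct]
  have h2 (i : Fin n) : (M *ᵥ δ) i.succ.succ = 0 :=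
    congrFun (mulVec_signedMinors (M.submatrix (fun i : Fin n => i.succ.succ) id)) i
  simp only [dotProduct, Fin.sum_univ_succ (n := n + 1), Fin.sum_univ_succ (n := n), h2, mul_zero,
    Finset.sum_const_zero, add_zero] at h1
  exact h1

/-- If `g 0` and `g 1` multiply an element `f` times all other generators into `(g 0, g 1)`, then
`f` annihilates the cokernel of the relation matrix without its first two rows. -/
theorem exists_mul_eq_smul_one {R : Type*} [CommRing R] {n : ℕ}
    {M : Matrix (Fin (n + 2)) (Fin (n + 1)) R} {g : Fin (n + 2) → R}
    (hex : Function.Exact M.mulVecLin (Fintype.linearCombination R g)) {f : R}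
    (hf : ∀ i, f * g i ∈ Ideal.span {g 0, g 1}) :
    ∃ V : Matrix (Fin (n + 1)) (Fin n) R, M.submatrix (fun i : Fin n => i.succ.succ) id * V = f • 1 := by
  have hcol (i : Fin n) : ∃ w : Fin (n + 1) → R,
      M.submatrix (fun i : Fin n => i.succ.succ) id *ᵥ w = Pi.single i f := by
    obtain ⟨a, b, hab⟩ := Ideal.mem_span_pair.1 (hf i.succ.succ)
    -- Writing `f * g i.succ.succ` as `a * g 0 + b * g 1` gives a syzygy whose last `n` coordinates
    -- form `Pi.single i f`.
    have : Fintype.linearCombination R g (Fin.cons (-a) (Fin.cons (-b) (Pi.single i f))) = 0 := by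
      rw [linearCombination_eq_dotProduct]
      simp only [dotProduct, Fin.sum_univ_succ, Fin.cons_zero, Fin.cons_succ]
      have hs : ∑ j, (Pi.single i f : Fin n → R) j * g j.succ.succ = f * g i.succ.succ :=
        single_dotProduct (fun j : Fin n => g j.succ.succ) f i
      rw [hs, ← hab, Fin.succ_zero_eq_one]
      ring
    obtain ⟨w, hw⟩ := (hex _).1 this
    refine ⟨w, ?_⟩
    ext j
    exact congrFun hw j.succ.succ
  choose w hw using hcol
  refine ⟨(Matrix.of w)ᵀ, ?_⟩
  ext i j
  have := congrFun (hw j) i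
  rw [Matrix.smul_apply, one_apply, smul_eq_mul, mul_ite, mul_one, mul_zero]
  rw [Pi.single_apply] at this
  exact this

theorem hasGenericResolution_of_isResidual {r : ℕ} {n : ℕ} {Z : Hilb (d r)} {Z' : Hilb n}
    (hZ : IsResidual (2 * (r + 1)) Z Z') (h : HasGenericResolution (r + 1) Z'.ideal) :
    HasGenericResolution r Z.ideal := by
  obtain ⟨F, G, hF0, hG0, hF, hG, hFG, -, -, hZ'⟩ := hZ
  have hcolon {f : S} : f ∈ Z'.ideal ↔ ∀ x ∈ Z.ideal, f * x ∈ Ideal.span {F, G} := by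
    rw [hZ', Submodule.mem_colon]
    rfl
  have hFZ' : F ∈ Z'.ideal :=
    hcolon.2 fun x _ => Ideal.mul_mem_right _ _ (Ideal.subset_span (by simp))
  have hGZ' : G ∈ Z'.ideal :=
    hcolon.2 fun x _ => Ideal.mul_mem_right _ _ (Ideal.subset_span (by simp))
  obtain ⟨M, g, hM, hinj, hex, hrange, rfl, rfl⟩ := h.exists_extending hFZ' hGZ' hF hG
    fun s t => smul_add_smul_eq_zero_of_isRelPrime (by omega) hG0 hG hFG
  have hgM : g ᵥ* M = 0 := by
    ext1 j
    have := (hex _).2 ⟨Pi.single j 1, rfl⟩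
    rw [mulVecLin_apply, linearCombination_eq_dotProduct, dotProduct_comm, dotProduct_mulVec,
      dotProduct_single_one] at this
    exact this
  let N := M.submatrix (fun i : Fin r => i.succ.succ) id
  have hN (i j) : (N i j).IsHomogeneous 2 := hM _ _
  have hrel : g 0 * (M 0 ⬝ᵥ signedMinors N) + g 1 * (M 1 ⬝ᵥ signedMinors N) = 0 :=
    mul_dotProduct_signedMinors_add hgM
  have hp0 : M 1 ⬝ᵥ signedMinors N ≠ 0 := dotProduct_signedMinors_ne_zero hF0 hgM hinj
  have hp : (M 1 ⬝ᵥ signedMinors N).IsHomogeneous (2 * (r + 1)) := by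
    rw [show 2 * (r + 1) = 2 + 2 * r by ring]
    exact IsHomogeneous.sum _ _ _ fun j _ => (hM 1 j).mul (isHomogeneous_signedMinors hN j)
  have hdvd : g 0 ∣ M 1 ⬝ᵥ signedMinors N :=
    hFG.dvd_of_dvd_mul_left ⟨-(M 0 ⬝ᵥ signedMinors N), by linear_combination hrel⟩
  -- Both forms have degree `2 * (r + 1)`, so the quotient is a constant.
  obtain ⟨c, hc, hpc⟩ := exists_eq_C_mul_of_dvd hp0 hF hp hdvd
  have hqc : M 0 ⬝ᵥ signedMinors N = C (-c) * g 1 := by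
    apply mul_left_cancel₀ hF0
    rw [hpc] at hrel
    rw [C_neg]
    linear_combination hrel
  have hrp : IsRelPrime (M 1 ⬝ᵥ signedMinors N) (M 0 ⬝ᵥ signedMinors N) := by
    rw [hpc, hqc]
    have hu : IsUnit (C c : S) := (isUnit_iff_ne_zero.2 hc).map C
    have hu' : IsUnit (C (-c) : S) := (isUnit_iff_ne_zero.2 (neg_ne_zero.2 hc)).map C
    exact (hFG.of_dvd_left (hu.mul_left_dvd.2 dvd_rfl)).of_dvd_right (hu'.mul_left_dvd.2 dvd_rfl)
  have hJ := hasGenericResolution_span_signedMinors hN hp0 hrp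
  rw [ideal_eq_of_le Z hJ]
  · exact hJ
  intro f hf
  obtain ⟨V, hV⟩ := exists_mul_eq_smul_one hex (f := f) fun i => by
    rw [mul_comm]
    refine hcolon.1 ?_ f hf
    rw [← hrange]
    exact ⟨Pi.single i 1, by simp⟩
  exact mem_span_signedMinors_of_mul_eq hp0 hrp hV

end Liaison

end PlanePoints

theorem mainTheorem3 (r : ℕ) (hr : 1 ≤ r) :
    PlanePoints.L (PlanePoints.D r) ⊆ PlanePoints.D (r + 1) := by
  rintro Z' ⟨Z, hZ, hres⟩ hZ'
  exact hZ (PlanePoints.hasGenericResolution_of_isResidual hres hZ')
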